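/- Let $H$ be a complex Hilbert space (necessarily separable and infinite-dimensional under the hypotheses below), and let $\{f_n\}_{n\in\mathbb{N}_0}\subset H$, $\mathbb{N}_0=\{0,1,2,\dots\}$, be a linearly independent frame for $H$; that is, the $f_n$ are linearly independent and there are constants $0<C_1\le C_2$ with $$C_1\|f\|^2\le\sum_{n\ge 0}|\langle f,f_n\rangle|^2\le C_2\|f\|^2\qquad\text{for all } f\in H .$$ Let $U:\ell^2(\mathbb{N}_0)\to H$, $U\{c_n\}=\sum_{n\ge 0}c_nf_n$, be its synthesis operator, $N_U=\ker U$, and let $S(x_0,x_1,\dots)=(0,x_0,x_1,\dots)$ be the right shift on $\ell^2(\mathbb{N}_0)$. For $c\in\ell^2(\mathbb{N}_0)$ let $V(c)$ be the function $z\mapsto\sum_{n\ge 0}c_nz^n$ on the open unit disk $\mathbb{D}$; the Hardy–Hilbert space $H^2(\mathbb{D})$ consists of the analytic functions on $\mathbb{D}$ whose power series have square-summable coefficients. An inner function is a function in $H^2(\mathbb{D})$ whose radial boundary values exist and have modulus $1$ at almost every point of the unit circle. A Riesz basis of $H$ is a family $\{Ae_n\}_{n\in\mathbb{N}_0}$ with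 $\{e_n\}_{n\in\mathbb{N}_0}$ an orthonormal basis of $H$ and $A:H\to H$ a bounded linear bijection. Then the following are equivalent: (i) there is a bounded linear operator $T:H\to H$ with $f_n=T^nf_0$ for all $n\ge 0$; (ii) $\{f_n\}_{n\in\mathbb{N}_0}$ is a Riesz basis of $H$, or there is $c\in\ell^2(\mathbb{N}_0)$ such that $V(c)$ is an inner function and $N_U=\overline{\operatorname{span}}\{S^nc:n\ge 0\}$. -/

import Mathlib

open Set Filter Topology MeasureTheory

noncomputable section

/-- The sequence `f` is a frame for `H`, with the series in the frame condition converging. -/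
def IsFrame {H : Type*} [NormedAddCommGroup H] [InnerProductSpace ℂ H] (f : ℕ → H) : Prop :=
  ∃ C₁ C₂ : ℝ, 0 < C₁ ∧ C₁ ≤ C₂ ∧ ∀ x : H,
    Summable (fun n => ‖inner ℂ x (f n)‖ ^ 2) ∧
    C₁ * ‖x‖ ^ 2 ≤ ∑' n, ‖inner ℂ x (f n)‖ ^ 2 ∧
    ∑' n, ‖inner ℂ x (f n)‖ ^ 2 ≤ C₂ * ‖x‖ ^ 2

/-- The sequence `f` is a Riesz basis for `H`: the image of an orthonormal basis of `H` under a
bounded linear bijection of `H`. -/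
def IsRieszBasis {H : Type*} [NormedAddCommGroup H] [InnerProductSpace ℂ H] (f : ℕ → H) : Prop :=
  ∃ (e : HilbertBasis ℕ ℂ H) (A : H →L[ℂ] H), Function.Bijective A ∧ ∀ n, f n = A (e n)

/-- The Hilbert space of square-summable complex sequences indexed by `ℕ = {0, 1, 2, …}`. -/
abbrev EllTwo : Type := lp (fun _ : ℕ => ℂ) 2

theorem EllTwo.hasSum_sq (c : EllTwo) : HasSum (fun n => ‖c n‖ ^ 2) (‖c‖ ^ 2) := by
  have h := lp.hasSum_norm (p := 2) (by norm_num) c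
  simpa using h

/-- Finite sums against a Bessel sequence are controlled by the coefficients. -/
theorem norm_sum_smul_sq_le {H : Type*} [NormedAddCommGroup H] [InnerProductSpace ℂ H]
    {f : ℕ → H} {C : ℝ} (hC : 0 ≤ C)
    (hf : ∀ x : H, Summable (fun n => ‖inner ℂ x (f n)‖ ^ 2) ∧
      ∑' n, ‖inner ℂ x (f n)‖ ^ 2 ≤ C * ‖x‖ ^ 2)
    (c : ℕ → ℂ) (s : Finset ℕ) :
    ‖∑ n ∈ s, c n • f n‖ ^ 2 ≤ C * ∑ n ∈ s, ‖c n‖ ^ 2 := by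
  set y := ∑ n ∈ s, c n • f n with hy
  have h1 : ‖y‖ ^ 2 ≤ ∑ n ∈ s, ‖c n‖ * ‖inner ℂ y (f n)‖ := by
    have h : (inner ℂ y y : ℂ) = ∑ n ∈ s, c n * inner ℂ y (f n) := by
      conv_lhs => rw [hy]
      rw [← hy, inner_sum]
      simp [inner_smul_right]
    calc ‖y‖ ^ 2 = ‖(inner ℂ y y : ℂ)‖ := by
          rw [inner_self_eq_norm_sq_to_K]; simp
      _ ≤ ∑ n ∈ s, ‖c n * inner ℂ y (f n)‖ := by rw [h]; exact norm_sum_le _ _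
      _ = _ := by simp
  have h2 := Finset.sum_mul_sq_le_sq_mul_sq s (fun n => ‖c n‖) (fun n => ‖inner ℂ y (f n)‖)
  have h3 : ∑ n ∈ s, ‖inner ℂ y (f n)‖ ^ 2 ≤ C * ‖y‖ ^ 2 :=
    ((hf y).1.sum_le_tsum s (fun _ _ => by positivity)).trans (hf y).2
  have h4 : 0 ≤ ∑ n ∈ s, ‖c n‖ ^ 2 := Finset.sum_nonneg fun _ _ => by positivity
  have h5 : (‖y‖ ^ 2) ^ 2 ≤ (∑ n ∈ s, ‖c n‖ ^ 2) * (C * ‖y‖ ^ 2) :=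
    (pow_le_pow_left₀ (by positivity) h1 2).trans (h2.trans (mul_le_mul_of_nonneg_left h3 h4))
  by_cases h0 : ‖y‖ ^ 2 = 0
  · rw [h0]; positivity
  · have : 0 < ‖y‖ ^ 2 := lt_of_le_of_ne (by positivity) (Ne.symm h0)
    nlinarith

theorem summable_smul_of_bessel {H : Type*} [NormedAddCommGroup H] [InnerProductSpace ℂ H]
    [CompleteSpace H] {f : ℕ → H} {C : ℝ} (hC : 0 ≤ C)
    (hf : ∀ x : H, Summable (fun n => ‖inner ℂ x (f n)‖ ^ 2) ∧
      ∑' n, ‖inner ℂ x (f n)‖ ^ 2 ≤ C * ‖x‖ ^ 2) (c : EllTwo) :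
    Summable (fun n => c n • f n) := by
  rw [summable_iff_vanishing_norm]
  intro ε hε
  have h := (summable_iff_vanishing_norm.1 (EllTwo.hasSum_sq c).summable)
    (ε ^ 2 / (C + 1)) (by positivity)
  obtain ⟨s, hs⟩ := h
  refine ⟨s, fun t ht => ?_⟩
  have h1 := norm_sum_smul_sq_le hC hf (fun n => c n) t
  have h4 : 0 ≤ ∑ n ∈ t, ‖c n‖ ^ 2 := Finset.sum_nonneg fun _ _ => by positivity
  have h2 := hs t ht
  rw [Real.norm_of_nonneg h4, lt_div_iff₀ (by positivity)] at h2
  refine lt_of_pow_lt_pow_left₀ 2 hε.le ?_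
  nlinarith

theorem IsFrame.exists_bessel {H : Type*} [NormedAddCommGroup H] [InnerProductSpace ℂ H]
    {f : ℕ → H} (hf : IsFrame f) :
    ∃ C : ℝ, 0 ≤ C ∧ ∀ x : H, Summable (fun n => ‖inner ℂ x (f n)‖ ^ 2) ∧
      ∑' n, ‖inner ℂ x (f n)‖ ^ 2 ≤ C * ‖x‖ ^ 2 := by
  obtain ⟨C₁, C₂, h1, h2, h⟩ := hf
  exact ⟨C₂, h1.le.trans h2, fun x => ⟨(h x).1, (h x).2.2⟩⟩

theorem IsFrame.summable_smul {H : Type*} [NormedAddCommGroup H] [InnerProductSpace ℂ H]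
    [CompleteSpace H] {f : ℕ → H} (hf : IsFrame f) (c : EllTwo) :
    Summable (fun n => c n • f n) := by
  obtain ⟨C, hC, h⟩ := hf.exists_bessel
  exact summable_smul_of_bessel hC h c

theorem IsFrame.exists_norm_le {H : Type*} [NormedAddCommGroup H] [InnerProductSpace ℂ H]
    [CompleteSpace H] {f : ℕ → H} (hf : IsFrame f) :
    ∃ K : ℝ, ∀ c : EllTwo, ‖∑' n, c n • f n‖ ≤ K * ‖c‖ := by
  obtain ⟨C, hC, h⟩ := hf.exists_bessel
  refine ⟨√C, fun c => ?_⟩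
  have h1 : ‖∑' n, c n • f n‖ ^ 2 ≤ C * ‖c‖ ^ 2 := by
    refine le_of_tendsto_of_tendsto ((hf.summable_smul c).hasSum.norm.pow 2)
      ((EllTwo.hasSum_sq c).const_mul C) (Eventually.of_forall fun s => ?_)
    exact norm_sum_smul_sq_le hC h (fun n => c n) s
  refine le_of_sq_le_sq ?_ (by positivity)
  rwa [mul_pow, Real.sq_sqrt hC]

/-- The synthesis operator `U c = ∑ c_n f_n` of a frame, as a bounded operator `ℓ²(ℕ) → H`. -/
def synthesisOperator {H : Type*} [NormedAddCommGroup H] [InnerProductSpace ℂ H]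
    [CompleteSpace H] (f : ℕ → H) (hf : IsFrame f) : EllTwo →L[ℂ] H :=
  LinearMap.mkContinuousOfExistsBound
    { toFun := fun c => ∑' n, c n • f n
      map_add' := fun c d => by
        simp only [lp.coeFn_add, Pi.add_apply, add_smul]
        exact (hf.summable_smul c).tsum_add (hf.summable_smul d)
      map_smul' := fun a c => by
        simp only [lp.coeFn_smul, Pi.smul_apply, smul_assoc, RingHom.id_apply]
        exact (hf.summable_smul c).tsum_const_smul a }
    hf.exists_norm_le

theorem synthesisOperator_hasSum {H : Type*} [NormedAddCommGroup H] [InnerProductSpace ℂ H]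
    [CompleteSpace H] {f : ℕ → H} (hf : IsFrame f) (c : EllTwo) :
    HasSum (fun n => c n • f n) (synthesisOperator f hf c) :=
  (hf.summable_smul c).hasSum

/-- The sequence `(0, x₀, x₁, x₂, …)`. -/
def shiftSeq (x : ℕ → ℂ) : ℕ → ℂ
  | 0 => 0
  | n + 1 => x n

theorem hasSum_shiftSeq_sq (c : EllTwo) :
    HasSum (fun n => ‖shiftSeq c n‖ ^ 2) (‖c‖ ^ 2) := by
  rw [← hasSum_nat_add_iff' 1]
  simpa [shiftSeq] using EllTwo.hasSum_sq c

theorem memℓp_shiftSeq (c : EllTwo) : Memℓp (shiftSeq c) 2 :=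
  memℓp_gen (by simpa using (hasSum_shiftSeq_sq c).summable)

/-- The right-shift operator `S (x₀, x₁, x₂, …) = (0, x₀, x₁, x₂, …)` on `ℓ²(ℕ)`. -/
def rightShift : EllTwo →L[ℂ] EllTwo :=
  LinearMap.mkContinuous
    { toFun := fun c => ⟨shiftSeq c, memℓp_shiftSeq c⟩
      map_add' := fun c d => by
        ext n
        change _ = shiftSeq c n + shiftSeq d n
        cases n <;> simp [shiftSeq]
      map_smul' := fun a c => by
        ext n; cases n <;> simp [shiftSeq] }
    1 (fun c => by
      rw [one_mul]
      refine le_of_sq_le_sq (le_of_eq ?_) (norm_nonneg _)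
      exact (EllTwo.hasSum_sq _).unique (hasSum_shiftSeq_sq c))

/-- The map `V`, sending `(c₀, c₁, …)` to the function `z ↦ ∑ c_n z^n`. Only its values on the
open unit disk are meaningful. -/
def hardyMap (c : EllTwo) : ℂ → ℂ := fun z => ∑' n, c n * z ^ n

/-- `g` restricted to the open unit disk belongs to the Hardy-Hilbert space: it is analytic there
and has a power series representation with square-summable coefficients. -/
def MemHardyTwo (g : ℂ → ℂ) : Prop :=
  AnalyticOnNhd ℂ g (Metric.ball 0 1) ∧
  ∃ a : ℕ → ℂ, Summable (fun n => ‖a n‖ ^ 2) ∧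
    ∀ z ∈ Metric.ball (0 : ℂ) 1, HasSum (fun n => a n * z ^ n) (g z)

theorem memHardyTwo_hardyMap (c : EllTwo) : MemHardyTwo (hardyMap c) := by
  have hb : ∀ n, ‖c n‖ ≤ ‖c‖ := fun n => lp.norm_apply_le_norm (by norm_num) c n
  have hs : ∀ z ∈ Metric.ball (0 : ℂ) 1, HasSum (fun n => c n * z ^ n) (hardyMap c z) := by
    intro z hz
    have hz' : ‖z‖ < 1 := by simpa using hz
    refine Summable.hasSum (Summable.of_norm_bounded
      ((summable_geometric_of_lt_one (norm_nonneg z) hz').mul_left ‖c‖) fun n => ?_)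
    rw [norm_mul, norm_pow]
    exact mul_le_mul_of_nonneg_right (hb n) (by positivity)
  refine ⟨?_, fun n => c n, (EllTwo.hasSum_sq c).summable, hs⟩
  have hp : HasFPowerSeriesOnBall (hardyMap c)
      (FormalMultilinearSeries.ofScalars ℂ (fun n => c n)) 0 1 := by
    refine ⟨?_, by norm_num, ?_⟩
    · refine FormalMultilinearSeries.le_radius_of_bound (r := 1) _ ‖c‖ fun n => ?_
      simpa [FormalMultilinearSeries.ofScalars_norm] using hb n
    · intro y hy
      have hy' : y ∈ Metric.ball (0 : ℂ) 1 := by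
        simpa [← ofReal_norm, ENNReal.ofReal_lt_one] using hy
      simpa [FormalMultilinearSeries.ofScalars_apply_eq, smul_eq_mul, mul_comm] using hs y hy'
  intro z hz
  refine hp.analyticAt_of_mem ?_
  simpa [← ofReal_norm, ENNReal.ofReal_lt_one] using hz

/-- An inner function: a function in the Hardy-Hilbert space whose radial limits exist and have
modulus one at almost every point `exp (iθ)` of the unit circle. -/
def IsInnerFunction (g : ℂ → ℂ) : Prop :=
  MemHardyTwo g ∧
  ∀ᵐ θ : ℝ ∂(volume.restrict (Ioc 0 (2 * Real.pi))), ∃ w : ℂ, ‖w‖ = 1 ∧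
    Tendsto (fun r : ℝ => g (r * Complex.exp (θ * Complex.I))) (𝓝[<] 1) (𝓝 w)

end

/-!
The lower frame bound makes `U U*` invertible, so `U` has a bounded right inverse. Hence an operator
`T` with `T ∘ U = U ∘ S`, equivalently with `T fₙ = fₙ₊₁`, exists if and only if `ker U` is
invariant under the shift `S`, and `f` is a Riesz basis if and only if `ker U = ⊥`. What remains is
Beurling's theorem for the closed invariant subspace `N = ker U`. If `N ≠ ⊥`, then `S N ≠ N` because
the ranges of the powers of `S` have trivial intersection, so there is a unit vector `c ∈ N`
orthogonal to `S N`. As `c` is orthogonal to all `Sᵏ c` with `k > 0`, the Fourier coefficients of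
`|φ|²`, where `φ` is the boundary function of `c`, are those of the constant `1`, so `|φ| = 1`.
If `x ∈ N` is orthogonal to all `Sᵏ c`, then likewise all Fourier coefficients of `φ̄ ψ` vanish, `ψ`
being the boundary function of `x`; hence `x = 0`, and the `Sᵏ c` span a dense subspace of `N`.

That `φ` is the radial limit of `V c` is Fatou's theorem. The primitive of `V c` extends
continuously to the closed disk, and by Lebesgue's differentiation theorem it is differentiable
along the circle at almost every point. It remains to see that if `F` is continuous on the closed
disk, holomorphic inside, and `F z = o(z - ζ)` on the circle, then the derivative of `F` at
`w = r ζ` tends to `0` as `r → 1`. First `F z / (1 - w̄ z)` and then `(F z - F w) / (z - w)` are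
bounded on the circle by expressions `ε + C |z - ζ|²`, which there are real parts of affine
functions; by the maximum principle such bounds persist inside the disk, and at `z = w` the second
one is the claim.
-/

section HilbertSpace

variable {𝕜 E F : Type*} [RCLike 𝕜] [NormedAddCommGroup E] [InnerProductSpace 𝕜 E]
  [NormedAddCommGroup F] [InnerProductSpace 𝕜 F]

theorem exists_comp_eq_id_of_le_norm_adjoint [CompleteSpace E] [CompleteSpace F] {U : E →L[𝕜] F}
    {C : ℝ} (hC : 0 < C) (hU : ∀ y, C * ‖y‖ ^ 2 ≤ ‖ContinuousLinearMap.adjoint U y‖ ^ 2) :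
    ∃ W : F →L[𝕜] E, U ∘L W = ContinuousLinearMap.id 𝕜 F := by
  have hunit : IsUnit (U ∘L ContinuousLinearMap.adjoint U) := by
    refine ContinuousLinearMap.isUnit_of_forall_le_norm_inner_map _ (c := C.toNNReal)
      (Real.toNNReal_pos.2 hC) fun y => ?_
    rw [Real.coe_toNNReal _ hC.le, ContinuousLinearMap.comp_apply,
      ← ContinuousLinearMap.adjoint_inner_right, inner_self_eq_norm_sq_to_K, norm_pow,
      RCLike.norm_ofReal, abs_norm, mul_comm]
    exact hU y
  obtain ⟨V, hV⟩ := hunit.exists_right_inv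
  exact ⟨ContinuousLinearMap.adjoint U ∘L V, hV⟩

theorem exists_comp_eq_comp_of_mapsTo_ker {U : E →L[𝕜] F} {W : F →L[𝕜] E}
    (hW : U ∘L W = ContinuousLinearMap.id 𝕜 F) {S : E →L[𝕜] E} (hS : MapsTo S U.ker U.ker) :
    ∃ T : F →L[𝕜] F, T ∘L U = U ∘L S := by
  refine ⟨U ∘L S ∘L W, ContinuousLinearMap.ext fun x => ?_⟩
  have hker : W (U x) - x ∈ U.ker := by
    have hWU : U (W (U x)) = U x := congrArg (fun A : F →L[𝕜] F => A (U x)) hW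
    simp [hWU]
  have hSker : U (S (W (U x) - x)) = 0 := hS hker
  rwa [map_sub, map_sub, sub_eq_zero] at hSker

theorem nonempty_hilbertBasis_of_linearIndependent [CompleteSpace E] {f : ℕ → E}
    (hf : LinearIndependent 𝕜 f)
    (hspan : ⊤ ≤ (Submodule.span 𝕜 (range f)).topologicalClosure) :
    Nonempty (HilbertBasis ℕ 𝕜 E) := by
  refine ⟨HilbertBasis.mk (InnerProductSpace.gramSchmidtNormed_orthonormal hf) ?_⟩
  rwa [InnerProductSpace.span_gramSchmidtNormed_range, InnerProductSpace.span_gramSchmidt]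

theorem exists_norm_eq_one_mem_orthogonal_of_lt {M N : Submodule 𝕜 E}
    [M.HasOrthogonalProjection] (h : M < N) : ∃ c ∈ N, ‖c‖ = 1 ∧ c ∈ Mᗮ := by
  have hne : Mᗮ ⊓ N ≠ ⊥ := fun hbot => h.ne <| by
    simpa [hbot] using Submodule.sup_orthogonal_inf_of_hasOrthogonalProjection h.le
  obtain ⟨x, ⟨hxM, hxN⟩, hx0⟩ := Submodule.exists_mem_ne_zero_of_ne_bot hne
  exact ⟨(‖x‖⁻¹ : 𝕜) • x, N.smul_mem _ hxN, norm_smul_inv_norm hx0, Mᗮ.smul_mem _ hxM⟩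

theorem mapsTo_topologicalClosure_span_range_pow (S : E →L[𝕜] E) (c : E) :
    MapsTo S (Submodule.span 𝕜 (range fun n : ℕ => (S ^ n) c)).topologicalClosure
      (Submodule.span 𝕜 (range fun n : ℕ => (S ^ n) c)).topologicalClosure := by
  refine MapsTo.closure (fun x hx => ?_) S.continuous
  refine (Submodule.span_le (p := (Submodule.span 𝕜 _).comap S.toLinearMap)).2 ?_ hx
  rintro _ ⟨n, rfl⟩
  exact Submodule.subset_span ⟨n + 1, by simp [pow_succ']⟩

theorem eq_bot_of_le_map_of_iInf_range_pow_eq_bot {S : E →L[𝕜] E}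
    (hS : ⨅ n : ℕ, (S ^ n).range = ⊥) {N : Submodule 𝕜 E} (hN : N ≤ N.map S.toLinearMap) :
    N = ⊥ := by
  have hpow (n : ℕ) : ∀ x ∈ N, ∃ y ∈ N, (S ^ n) y = x := by
    induction n with
    | zero => exact fun x hx => ⟨x, hx, rfl⟩
    | succ n ih =>
      intro x hx
      obtain ⟨y, hy, rfl⟩ := ih x hx
      obtain ⟨z, hz, rfl⟩ := hN hy
      exact ⟨z, hz, by simp [pow_succ]⟩
  refine eq_bot_iff.2 (hS ▸ le_iInf fun n x hx => ?_)
  obtain ⟨y, -, hy⟩ := hpow n x hx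
  exact ⟨y, hy⟩

theorem exists_wandering_unit_vector [CompleteSpace E] {S : E →L[𝕜] E} (hS : Isometry S)
    (hpure : ⨅ n : ℕ, (S ^ n).range = ⊥) {N : Submodule 𝕜 E} (hN : IsClosed (N : Set E))
    (hSN : MapsTo S N N) (h0 : N ≠ ⊥) : ∃ c ∈ N, ‖c‖ = 1 ∧ ∀ y ∈ N, inner 𝕜 (S y) c = 0 := by
  have hclosed : IsClosed (N.map S.toLinearMap : Set E) :=
    hS.isClosedEmbedding.isClosedMap _ hN
  have := hclosed.completeSpace_coe
  have hlt : N.map S.toLinearMap < N :=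
    (Submodule.map_le_iff_le_comap.2 hSN).lt_of_not_ge fun hle =>
      h0 (eq_bot_of_le_map_of_iInf_range_pow_eq_bot hpure hle)
  obtain ⟨c, hcN, hc1, hc⟩ := exists_norm_eq_one_mem_orthogonal_of_lt hlt
  exact ⟨c, hcN, hc1, fun y hy => hc _ (Submodule.mem_map_of_mem hy)⟩

end HilbertSpace

section Shift

@[simp]
theorem rightShift_apply_zero (c : EllTwo) : rightShift c 0 = 0 := rfl

@[simp]
theorem rightShift_apply_succ (c : EllTwo) (n : ℕ) : rightShift c (n + 1) = c n := rfl

theorem isometry_rightShift : Isometry rightShift := by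
  refine AddMonoidHomClass.isometry_of_norm rightShift fun c => ?_
  exact (sq_eq_sq₀ (norm_nonneg _) (norm_nonneg _)).1
    ((EllTwo.hasSum_sq _).unique (hasSum_shiftSeq_sq c))

theorem rightShift_single (n : ℕ) :
    rightShift (lp.single 2 n 1) = lp.single 2 (n + 1) 1 := by
  ext m
  cases m <;> simp [lp.single_apply, Pi.single_apply]

theorem rightShift_pow_apply (c : EllTwo) (k n : ℕ) :
    (rightShift ^ k) c n = if k ≤ n then c (n - k) else 0 := by
  induction k generalizing n with
  | zero => simp
  | succ k ih =>
    rw [pow_succ', mul_apply_eq_comp]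
    cases n with
    | zero => simp
    | succ n =>
      rw [rightShift_apply_succ, ih]
      simp

theorem iInf_range_rightShift_pow : ⨅ n : ℕ, (rightShift ^ n).range = ⊥ := by
  refine eq_bot_iff.2 fun x hx => ?_
  ext n
  obtain ⟨y, rfl⟩ := (Submodule.mem_iInf _).1 hx (n + 1)
  exact (rightShift_pow_apply y (n + 1) n).trans (if_neg (by omega))

end Shift

section Frame

variable {H : Type*} [NormedAddCommGroup H] [InnerProductSpace ℂ H] [CompleteSpace H] {f : ℕ → H}

theorem synthesisOperator_single (hf : IsFrame f) (n : ℕ) :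
    synthesisOperator f hf (lp.single 2 n 1) = f n := by
  refine (synthesisOperator_hasSum hf _).unique ?_
  convert hasSum_single n fun m hm => ?_ using 1
  · simp
  · simp [lp.single_apply, hm]

theorem adjoint_synthesisOperator_apply (hf : IsFrame f) (x : H) (n : ℕ) :
    ContinuousLinearMap.adjoint (synthesisOperator f hf) x n = inner ℂ (f n) x := by
  rw [← synthesisOperator_single hf n, ← ContinuousLinearMap.adjoint_inner_right,
    lp.inner_single_left]
  simp

theorem exists_synthesisOperator_comp_eq_id (hf : IsFrame f) :
    ∃ W : H →L[ℂ] EllTwo, synthesisOperator f hf ∘L W = ContinuousLinearMap.id ℂ H := by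
  obtain ⟨C₁, C₂, hC₁, -, h⟩ := id hf
  refine exists_comp_eq_id_of_le_norm_adjoint hC₁ fun x => ?_
  rw [← (EllTwo.hasSum_sq _).tsum_eq]
  simpa only [adjoint_synthesisOperator_apply, norm_inner_symm] using (h x).2.1

theorem synthesisOperator_surjective (hf : IsFrame f) :
    Function.Surjective (synthesisOperator f hf) := by
  obtain ⟨W, hW⟩ := exists_synthesisOperator_comp_eq_id hf
  exact fun x => ⟨W x, congrArg (fun A : H →L[ℂ] H => A x) hW⟩

theorem topologicalClosure_span_range_eq_top (hf : IsFrame f) :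
    (Submodule.span ℂ (range f)).topologicalClosure = ⊤ := by
  refine eq_top_iff.2 fun x _ => ?_
  obtain ⟨c, rfl⟩ := synthesisOperator_surjective hf x
  refine mem_closure_of_tendsto (synthesisOperator_hasSum hf c) (Eventually.of_forall fun s => ?_)
  exact Submodule.sum_mem _ fun n _ => Submodule.smul_mem _ _ (Submodule.subset_span ⟨n, rfl⟩)

theorem synthesisOperator_rightShift (hf : IsFrame f) {T : H →L[ℂ] H}
    (hT : ∀ n : ℕ, f n = (T ^ n) (f 0)) (c : EllTwo) :
    synthesisOperator f hf (rightShift c) = T (synthesisOperator f hf c) := by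
  have hTf (n : ℕ) : T (f n) = f (n + 1) := by
    rw [hT (n + 1), pow_succ', mul_apply_eq_comp, ← hT n]
  refine (synthesisOperator_hasSum hf (rightShift c)).unique ?_
  rw [← hasSum_nat_add_iff' 1]
  simpa [hTf] using (synthesisOperator_hasSum hf c).mapL T

theorem exists_eq_pow_apply_iff_mapsTo_ker (hf : IsFrame f) :
    (∃ T : H →L[ℂ] H, ∀ n : ℕ, f n = (T ^ n) (f 0)) ↔
      MapsTo rightShift (synthesisOperator f hf).ker (synthesisOperator f hf).ker := by
  constructor
  · rintro ⟨T, hT⟩ x (hx : synthesisOperator f hf x = 0)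
    change synthesisOperator f hf (rightShift x) = 0
    rw [synthesisOperator_rightShift hf hT, hx, map_zero]
  · intro hker
    obtain ⟨W, hW⟩ := exists_synthesisOperator_comp_eq_id hf
    obtain ⟨T, hT⟩ := exists_comp_eq_comp_of_mapsTo_ker hW hker
    have hTf (n : ℕ) : T (f n) = f (n + 1) := by
      rw [← synthesisOperator_single hf n, ← synthesisOperator_single hf (n + 1),
        ← rightShift_single]
      exact congrArg (fun A : EllTwo →L[ℂ] H => A (lp.single 2 n 1)) hT
    refine ⟨T, fun n => ?_⟩
    induction n with
    | zero => rfl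
    | succ n ih => rw [pow_succ', mul_apply_eq_comp, ← ih, hTf]

theorem linearIndependent_of_ker_synthesisOperator_eq_bot (hf : IsFrame f)
    (h : (synthesisOperator f hf).ker = ⊥) : LinearIndependent ℂ f := by
  have horth : Orthonormal ℂ fun n : ℕ => (lp.single 2 n 1 : EllTwo) := by
    classical
    rw [orthonormal_iff_ite]
    intro i j
    rw [lp.inner_single_left]
    simp [lp.single_apply, Pi.single_apply]
  simpa only [Function.comp_def, ContinuousLinearMap.coe_coe, synthesisOperator_single] using
    horth.linearIndependent.map' (synthesisOperator f hf).toLinearMap h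

theorem isRieszBasis_iff_ker_synthesisOperator_eq_bot (hf : IsFrame f) :
    IsRieszBasis f ↔ (synthesisOperator f hf).ker = ⊥ := by
  constructor
  · rintro ⟨e, A, hA, hfe⟩
    refine (Submodule.eq_bot_iff _).2 fun c (hc : synthesisOperator f hf c = 0) => ?_
    have hsum : HasSum (fun n => c n • f n) (A (e.repr.symm c)) := by
      simpa [hfe] using (e.hasSum_repr_symm c).mapL A
    have hAc : A (e.repr.symm c) = 0 := (hsum.unique (synthesisOperator_hasSum hf c)).trans hc
    simpa using hA.1 (hAc.trans (map_zero A).symm)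
  · intro h
    obtain ⟨e⟩ := nonempty_hilbertBasis_of_linearIndependent
      (linearIndependent_of_ker_synthesisOperator_eq_bot hf h)
      (topologicalClosure_span_range_eq_top hf).ge
    have hU : Function.Bijective (synthesisOperator f hf) :=
      ⟨LinearMap.ker_eq_bot.1 h, synthesisOperator_surjective hf⟩
    exact ⟨e, synthesisOperator f hf ∘L (e.repr : H →L[ℂ] EllTwo), hU.comp e.repr.bijective,
      fun n => (synthesisOperator_single hf n).symm.trans (congrArg _ (e.repr_self n).symm)⟩

end Frame

section FourierUniqueness

open AddCircle NNReal BoundedContinuousFunction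

variable {E : Type*} [NormedAddCommGroup E] [CompleteSpace E]

theorem ae_eq_zero_of_forall_integral_boundedContinuousFunction_smul_eq_zero [NormedSpace ℝ E]
    {X : Type*} [TopologicalSpace X] [HasOuterApproxClosed X] [MeasurableSpace X] [BorelSpace X]
    {μ : Measure X} {h : X → E} (hh : Integrable h μ)
    (h0 : ∀ g : X →ᵇ ℝ≥0, ∫ x, (g x : ℝ) • h x ∂μ = 0) : h =ᵐ[μ] 0 := by
  refine ae_eq_zero_of_forall_setIntegral_isClosed_eq_zero hh fun K hK => ?_
  rw [← integral_indicator hK.measurableSet]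
  have hlim : Tendsto (fun n => ∫ x, (hK.apprSeq n x : ℝ) • h x ∂μ) atTop
      (𝓝 (∫ x, K.indicator h x ∂μ)) := by
    refine tendsto_integral_of_dominated_convergence (fun x => ‖h x‖) (fun n => ?_) hh.norm
      (fun n => Eventually.of_forall fun x => ?_) (Eventually.of_forall fun x => ?_)
    · have hcont := (hK.apprSeq n).continuous
      exact (by fun_prop : Measurable fun x => (hK.apprSeq n x : ℝ)).aestronglyMeasurable.smul hh.1
    · rw [norm_smul, NNReal.norm_eq]
      exact mul_le_of_le_one_left (norm_nonneg _)
        (HasOuterApproxClosed.apprSeq_apply_le_one hK n x)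
    · have hx := NNReal.tendsto_coe.2
        (tendsto_pi_nhds.1 (HasOuterApproxClosed.tendsto_apprSeq hK) x)
      convert hx.smul_const (h x) using 2
      by_cases hxK : x ∈ K <;> simp [hxK]
  simp only [h0] at hlim
  exact tendsto_nhds_unique hlim tendsto_const_nhds

variable {T : ℝ} [hT : Fact (0 < T)] [NormedSpace ℂ E]

theorem integral_continuousMap_smul_eq_zero_of_fourierCoeff_eq_zero {h : AddCircle T → E}
    (hh : Integrable h haarAddCircle) (h0 : ∀ n, fourierCoeff h n = 0) (g : C(AddCircle T, ℂ)) :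
    ∫ x, g x • h x ∂haarAddCircle = 0 := by
  let Φ : C(AddCircle T, ℂ) →L[ℂ] E :=
    (((ContinuousLinearMap.lsmul ℂ ℂ (E := E)).lpPairing haarAddCircle ⊤ 1).flip
      (memLp_one_iff_integrable.2 hh).toLp) ∘L ContinuousMap.toLp ⊤ haarAddCircle ℂ
  have hΦ (g : C(AddCircle T, ℂ)) : Φ g = ∫ x, g x • h x ∂haarAddCircle := by
    refine (ContinuousLinearMap.lpPairing_eq_integral _ _ _).trans (integral_congr_ae ?_)
    filter_upwards [ContinuousMap.coeFn_toLp (p := ⊤) (𝕜 := ℂ) haarAddCircle g,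
      (memLp_one_iff_integrable.2 hh).coeFn_toLp] with x hg hh
    rw [hh]
    exact congrArg (· • h x) hg
  have hΦ0 : Φ = 0 := by
    refine ContinuousLinearMap.ext_on (s := range (@fourier T)) ?_ ?_
    · exact Submodule.dense_iff_topologicalClosure_eq_top.2 span_fourier_closure_eq_top
    · rintro _ ⟨n, rfl⟩
      simpa [hΦ, fourierCoeff] using h0 (-n)
  rw [← hΦ, hΦ0, zero_apply]

theorem ae_eq_zero_of_fourierCoeff_eq_zero {h : AddCircle T → E}
    (hh : Integrable h haarAddCircle) (h0 : ∀ n, fourierCoeff h n = 0) :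
    h =ᵐ[haarAddCircle] 0 :=
  ae_eq_zero_of_forall_integral_boundedContinuousFunction_smul_eq_zero hh fun g =>
    integral_continuousMap_smul_eq_zero_of_fourierCoeff_eq_zero hh h0
      ⟨fun x => ((g x : ℝ) : ℂ), by fun_prop⟩

theorem ae_eq_of_fourierCoeff_eq {g h : AddCircle T → E} (hg : Integrable g haarAddCircle)
    (hh : Integrable h haarAddCircle) (hgh : ∀ n, fourierCoeff g n = fourierCoeff h n) :
    g =ᵐ[haarAddCircle] h := by
  refine (ae_eq_zero_of_fourierCoeff_eq_zero (hg.sub hh) fun n => ?_).mono fun x => sub_eq_zero.1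
  simp only [fourierCoeff, Pi.sub_apply, smul_sub] at hgh ⊢
  rw [integral_sub (hg.fourier_smul _) (hh.fourier_smul _), hgh, sub_self]

end FourierUniqueness

section BoundaryFunction

open AddCircle

variable {T : ℝ} [hT : Fact (0 < T)]

variable (T) in
theorem orthogonalFamily_fourierLp_natCast :
    OrthogonalFamily ℂ (fun _ : ℕ => ℂ) fun n : ℕ =>
      LinearIsometry.toSpanSingleton ℂ (Lp ℂ 2 (@haarAddCircle T hT))
        ((orthonormal_fourier (T := T)).1 (n : ℤ)) :=
  ((orthonormal_fourier (T := T)).comp _ Nat.cast_injective).orthogonalFamily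

variable (T) in
/-- The boundary function `∑ cₙ e^{2πinx/T}` of `hardyMap c`, as a square-integrable function on the
circle of circumference `T`. -/
noncomputable def hardyBoundary : EllTwo →ₗᵢ[ℂ] Lp ℂ 2 (@haarAddCircle T hT) :=
  (orthogonalFamily_fourierLp_natCast T).linearIsometry

theorem hasSum_hardyBoundary (c : EllTwo) :
    HasSum (fun n : ℕ => c n • fourierLp (T := T) 2 (n : ℤ)) (hardyBoundary T c) :=
  (orthogonalFamily_fourierLp_natCast T).hasSum_linearIsometry c

theorem integrable_coeFn_lp_two (g : Lp ℂ 2 (@haarAddCircle T hT)) : Integrable g haarAddCircle :=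
  (Lp.memLp g).integrable one_le_two

theorem fourierCoeff_fourier_mul (g : AddCircle T → ℂ) (k n : ℤ) :
    fourierCoeff (fun x => fourier k x * g x) n = fourierCoeff g (n - k) := by
  refine integral_congr_ae (Eventually.of_forall fun x => ?_)
  simp only [smul_eq_mul]
  rw [← mul_assoc, ← fourier_add, neg_sub, neg_add_eq_sub]

theorem fourierCoeff_const (a : ℂ) (n : ℤ) :
    fourierCoeff (fun _ : AddCircle T => a) n = if n = 0 then a else 0 := by
  have h : (fun _ : AddCircle T => a) = a • ⇑(fourier (T := T) 0) := by
    ext x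
    simp
  rw [h, fourierCoeff.const_smul, fourierCoeff_fourier, Pi.single_apply, smul_ite, smul_eq_mul,
    mul_one, smul_zero]

theorem hasSum_fourierCoeff_hardyBoundary (c : EllTwo) (n : ℤ) :
    HasSum (fun m : ℕ => if n = m then c m else 0) (fourierCoeff (hardyBoundary T c) n) := by
  have h := (hasSum_hardyBoundary (T := T) c).mapL (innerSL ℂ (fourierLp (T := T) 2 n))
  rw [← fourierBasis_repr, HilbertBasis.repr_apply_apply, coe_fourierBasis]
  simpa [inner_smul_right, orthonormal_iff_ite.1 (orthonormal_fourier (T := T))] using h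

theorem fourierCoeff_hardyBoundary_natCast (c : EllTwo) (n : ℕ) :
    fourierCoeff (hardyBoundary T c) n = c n := by
  refine (hasSum_fourierCoeff_hardyBoundary c n).unique ?_
  simpa only [Nat.cast_inj, if_true] using hasSum_single n fun m hm => if_neg hm.symm

theorem fourierCoeff_hardyBoundary_of_neg (c : EllTwo) {n : ℤ} (hn : n < 0) :
    fourierCoeff (hardyBoundary T c) n = 0 := by
  refine (hasSum_fourierCoeff_hardyBoundary c n).unique ?_
  convert hasSum_zero using 2 with m
  exact if_neg (by omega)

theorem hardyBoundary_rightShift_pow (c : EllTwo) (k : ℕ) :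
    hardyBoundary T ((rightShift ^ k) c) =ᵐ[haarAddCircle]
      fun x => fourier (k : ℤ) x * hardyBoundary T c x := by
  refine ae_eq_of_fourierCoeff_eq (integrable_coeFn_lp_two _)
    ((integrable_coeFn_lp_two (hardyBoundary T c)).fourier_smul k) fun n => ?_
  rw [fourierCoeff_fourier_mul]
  rcases lt_or_ge n 0 with hn | hn
  · rw [fourierCoeff_hardyBoundary_of_neg _ hn, fourierCoeff_hardyBoundary_of_neg _ (by omega)]
  lift n to ℕ using hn
  rw [fourierCoeff_hardyBoundary_natCast, rightShift_pow_apply]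
  split_ifs with hkn
  · rw [← Nat.cast_sub hkn, fourierCoeff_hardyBoundary_natCast]
  · rw [fourierCoeff_hardyBoundary_of_neg _ (by omega)]

theorem integral_conj_mul_hardyBoundary (c d : EllTwo) :
    ∫ x, starRingEnd ℂ (hardyBoundary T c x) * hardyBoundary T d x ∂haarAddCircle =
      inner ℂ c d := by
  rw [← (hardyBoundary T).inner_map_map, L2.inner_def]
  simp only [RCLike.inner_apply, mul_comm]

theorem integrable_conj_mul_hardyBoundary (c d : EllTwo) :
    Integrable (fun x => starRingEnd ℂ (hardyBoundary T c x) * hardyBoundary T d x)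
      haarAddCircle := by
  simpa only [RCLike.inner_apply, mul_comm] using
    L2.integrable_inner (𝕜 := ℂ) (hardyBoundary T c) (hardyBoundary T d)

theorem fourierCoeff_conj_mul_hardyBoundary_natCast (c d : EllTwo) (k : ℕ) :
    fourierCoeff (fun x => starRingEnd ℂ (hardyBoundary T c x) * hardyBoundary T d x) k =
      inner ℂ ((rightShift ^ k) c) d := by
  rw [← integral_conj_mul_hardyBoundary (T := T)]
  refine integral_congr_ae ?_
  filter_upwards [hardyBoundary_rightShift_pow (T := T) c k] with x hx
  rw [hx, fourier_neg, map_mul, smul_eq_mul, mul_assoc]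

theorem fourierCoeff_conj_mul_hardyBoundary_neg_natCast (c d : EllTwo) (k : ℕ) :
    fourierCoeff (fun x => starRingEnd ℂ (hardyBoundary T c x) * hardyBoundary T d x) (-k) =
      inner ℂ c ((rightShift ^ k) d) := by
  rw [← integral_conj_mul_hardyBoundary (T := T)]
  refine integral_congr_ae ?_
  filter_upwards [hardyBoundary_rightShift_pow (T := T) d k] with x hx
  rw [hx, neg_neg, smul_eq_mul, mul_left_comm]

theorem conj_mul_hardyBoundary_ae_eq_inner {c d : EllTwo}
    (hcd : ∀ k : ℕ, (inner ℂ ((rightShift ^ (k + 1)) c) d : ℂ) = 0)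
    (hdc : ∀ k : ℕ, (inner ℂ ((rightShift ^ (k + 1)) d) c : ℂ) = 0) :
    (fun x => starRingEnd ℂ (hardyBoundary T c x) * hardyBoundary T d x) =ᵐ[haarAddCircle]
      fun _ => inner ℂ c d := by
  refine ae_eq_of_fourierCoeff_eq (integrable_conj_mul_hardyBoundary c d) (integrable_const _)
    fun n => ?_
  rw [fourierCoeff_const]
  obtain ⟨_ | k, rfl | rfl⟩ := n.eq_nat_or_neg
  · simpa using fourierCoeff_conj_mul_hardyBoundary_natCast (T := T) c d 0
  · simpa using fourierCoeff_conj_mul_hardyBoundary_natCast (T := T) c d 0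
  · rw [if_neg (by omega), fourierCoeff_conj_mul_hardyBoundary_natCast, hcd]
  · rw [if_neg (by omega), fourierCoeff_conj_mul_hardyBoundary_neg_natCast, ← inner_conj_symm, hdc,
      map_zero]

theorem norm_hardyBoundary_eq_one {c : EllTwo} (hc : ‖c‖ = 1)
    (hcc : ∀ k : ℕ, (inner ℂ ((rightShift ^ (k + 1)) c) c : ℂ) = 0) :
    ∀ᵐ x ∂(@haarAddCircle T hT), ‖hardyBoundary T c x‖ = 1 := by
  filter_upwards [conj_mul_hardyBoundary_ae_eq_inner (T := T) hcc hcc] with x hx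
  rw [Complex.conj_mul', inner_self_eq_norm_sq_to_K, hc, RCLike.ofReal_one, one_pow] at hx
  exact (pow_eq_one_iff_of_nonneg (norm_nonneg _) two_ne_zero).1 (by exact_mod_cast hx)

theorem eq_zero_of_inner_rightShift_pow_eq_zero {c x : EllTwo}
    (hc : ∀ᵐ t ∂(@haarAddCircle T hT), hardyBoundary T c t ≠ 0)
    (hcx : ∀ k : ℕ, (inner ℂ ((rightShift ^ k) c) x : ℂ) = 0)
    (hxc : ∀ k : ℕ, (inner ℂ ((rightShift ^ (k + 1)) x) c : ℂ) = 0) : x = 0 := by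
  have h0 : hardyBoundary T x = 0 := by
    rw [Lp.eq_zero_iff_ae_eq_zero]
    filter_upwards [hc, conj_mul_hardyBoundary_ae_eq_inner (T := T) (fun k => hcx (k + 1)) hxc]
      with t ht htx
    rw [show (inner ℂ c x : ℂ) = 0 from hcx 0] at htx
    exact (mul_eq_zero.1 htx).resolve_left ((map_ne_zero _).2 ht)
  exact (map_eq_zero_iff _ (hardyBoundary T).injective).1 h0

variable (T) in
theorem exists_norm_hardyBoundary_eq_one_and_eq_topologicalClosure_span {N : Submodule ℂ EllTwo}
    (hN : IsClosed (N : Set EllTwo)) (hS : MapsTo rightShift N N) (h0 : N ≠ ⊥) :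
    ∃ c : EllTwo, (∀ᵐ x ∂(@haarAddCircle T hT), ‖hardyBoundary T c x‖ = 1) ∧
      N = (Submodule.span ℂ (range fun n : ℕ => (rightShift ^ n) c)).topologicalClosure := by
  obtain ⟨c, hcN, hc1, hc⟩ :=
    exists_wandering_unit_vector isometry_rightShift iInf_range_rightShift_pow hN hS h0
  have hSpow (k : ℕ) : MapsTo (rightShift ^ k : EllTwo →L[ℂ] EllTwo) N N := by
    simpa using hS.iterate k
  have hpow (x : EllTwo) (hx : x ∈ N) (k : ℕ) :
      (inner ℂ ((rightShift ^ (k + 1)) x) c : ℂ) = 0 := by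
    rw [pow_succ']
    exact hc _ (hSpow k hx)
  have hunit := norm_hardyBoundary_eq_one (T := T) hc1 (hpow c hcN)
  refine ⟨c, hunit, (eq_of_le_of_not_lt ?_ fun hlt => ?_).symm⟩
  · refine Submodule.topologicalClosure_minimal _ (Submodule.span_le.2 ?_) hN
    rintro _ ⟨n, rfl⟩
    exact hSpow n hcN
  · have := (Submodule.isClosed_topologicalClosure
      (Submodule.span ℂ (range fun n : ℕ => (rightShift ^ n) c))).completeSpace_coe
    obtain ⟨x, hxN, hx1, hx⟩ := exists_norm_eq_one_mem_orthogonal_of_lt hlt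
    refine norm_ne_zero_iff.1 (hx1.trans_ne one_ne_zero)
      (eq_zero_of_inner_rightShift_pow_eq_zero (T := T) (c := c) ?_ (fun k => ?_) (hpow x hxN))
    · exact hunit.mono fun t ht => norm_ne_zero_iff.1 (ht.trans_ne one_ne_zero)
    · exact hx _ (Submodule.le_topologicalClosure _ (Submodule.subset_span ⟨k, rfl⟩))

end BoundaryFunction

section RadialDerivative

open Metric

variable {E : Type*} [NormedAddCommGroup E] [NormedSpace ℂ E]

theorem norm_le_re_of_forall_mem_frontier_norm_le_re {V : Type*} [NormedAddCommGroup V]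
    [NormedSpace ℂ V] [Nontrivial V] {U : Set V} (hU : Bornology.IsBounded U) {G : V → E}
    {h : V → ℂ} (hG : DiffContOnCl ℂ G U) (hh : DiffContOnCl ℂ h U)
    (hle : ∀ z ∈ frontier U, ‖G z‖ ≤ (h z).re) {z : V} (hz : z ∈ closure U) :
    ‖G z‖ ≤ (h z).re := by
  obtain ⟨ℓ, hℓ, hℓz⟩ := exists_dual_vector'' ℂ (G z)
  have hdiff : DiffContOnCl ℂ (fun y => Complex.exp (ℓ (G y) - h y)) U :=
    Complex.differentiable_exp.comp_diffContOnCl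
      ((ℓ.differentiable.comp_diffContOnCl hG).sub hh)
  have hnorm := Complex.norm_le_of_forall_mem_frontier_norm_le (C := 1) hU hdiff (fun y hy => ?_) hz
  · rwa [Complex.norm_exp, Real.exp_le_one_iff, Complex.sub_re, sub_nonpos, hℓz] at hnorm
  · rw [Complex.norm_exp, Real.exp_le_one_iff, Complex.sub_re, sub_nonpos]
    calc (ℓ (G y)).re ≤ ‖ℓ (G y)‖ := Complex.re_le_norm _
      _ ≤ ‖G y‖ := ℓ.le_of_opNorm_le hℓ _ |>.trans_eq (one_mul _)
      _ ≤ (h y).re := hle y hy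

theorem norm_le_of_norm_le_add_mul_sq_on_sphere {G : ℂ → E}
    (hG : DiffContOnCl ℂ G (ball 0 1)) {ζ : ℂ} (hζ : ‖ζ‖ = 1) {a b : ℝ}
    (hle : ∀ z ∈ sphere (0 : ℂ) 1, ‖G z‖ ≤ a + b * ‖z - ζ‖ ^ 2) {r : ℝ} (hr : r ∈ Icc 0 1) :
    ‖G (r * ζ)‖ ≤ a + 2 * b * (1 - r) := by
  have hζζ : starRingEnd ℂ ζ * ζ = 1 := by simp [Complex.conj_mul', hζ]
  have hh : Differentiable ℂ fun z => (a : ℂ) + (2 * b : ℝ) * (1 - starRingEnd ℂ ζ * z) := by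
    fun_prop
  have hmem : (r : ℂ) * ζ ∈ closure (ball (0 : ℂ) 1) := by
    simpa [closure_ball, hζ, abs_of_nonneg hr.1] using hr.2
  have hre := norm_le_re_of_forall_mem_frontier_norm_le_re isBounded_ball hG hh.diffContOnCl
    (fun z hz => ?_) hmem
  · simpa [mul_left_comm, hζζ] using hre
  · rw [frontier_ball _ one_ne_zero] at hz
    -- On the unit circle, `‖z - ζ‖ ^ 2` is the real part of the affine function `2 * (1 - ζ̄ * z)`.
    have hsq : ‖z - ζ‖ ^ 2 = 2 * (1 - (starRingEnd ℂ ζ * z).re) := by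
      rw [norm_sub_sq (𝕜 := ℂ), ← inner_conj_symm, RCLike.conj_re, mem_sphere_zero_iff_norm.1 hz,
        hζ, RCLike.inner_apply, mul_comm z, RCLike.re_to_complex, one_pow]
      ring
    refine (hle z hz).trans_eq ?_
    rw [hsq, Complex.add_re, Complex.ofReal_re, Complex.re_ofReal_mul, Complex.sub_re,
      Complex.one_re]
    ring

theorem exists_norm_le_add_mul_sq_mul_of_isLittleO {V F : Type*} [SeminormedAddCommGroup V]
    [SeminormedAddCommGroup F] {f : V → F} {s : Set V} {x : V} {M : ℝ}
    (hM : ∀ z ∈ s, ‖f z‖ ≤ M) (hf : f =o[𝓝[s] x] fun z => z - x) {ε : ℝ} (hε : 0 < ε) :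
    ∃ C, 0 ≤ C ∧ ∀ z ∈ s, ‖f z‖ ≤ (ε + C * ‖z - x‖ ^ 2) * ‖z - x‖ := by
  obtain ⟨δ, hδ, hδf⟩ := Metric.mem_nhdsWithin_iff.1 (hf.def hε)
  refine ⟨|M| / δ ^ 3, by positivity, fun z hz => ?_⟩
  rcases lt_or_ge (dist z x) δ with hlt | hge
  · calc ‖f z‖ ≤ ε * ‖z - x‖ := hδf ⟨hlt, hz⟩
      _ ≤ (ε + |M| / δ ^ 3 * ‖z - x‖ ^ 2) * ‖z - x‖ := by
        gcongr
        exact le_add_of_nonneg_right (by positivity)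
  · rw [dist_eq_norm] at hge
    calc ‖f z‖ ≤ |M| / δ ^ 3 * δ ^ 3 := by
          rw [div_mul_cancel₀ _ (by positivity)]
          exact (hM z hz).trans (le_abs_self M)
      _ ≤ |M| / δ ^ 3 * ‖z - x‖ ^ 3 := by gcongr
      _ ≤ ε * ‖z - x‖ + |M| / δ ^ 3 * ‖z - x‖ ^ 3 := le_add_of_nonneg_left (by positivity)
      _ = (ε + |M| / δ ^ 3 * ‖z - x‖ ^ 2) * ‖z - x‖ := by ring

theorem hasDerivWithinAt_range_ofReal_iff {g : ℂ → E} {v : E} {x : ℝ} :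
    HasDerivWithinAt g v (range ((↑) : ℝ → ℂ)) x ↔ HasDerivAt (fun t : ℝ => g t) v x := by
  rw [hasDerivWithinAt_iff_isLittleO, hasDerivAt_iff_isLittleO,
    ← Complex.isometry_ofReal.isEmbedding.map_nhds_eq, Asymptotics.isLittleO_map]
  simp only [Function.comp_def, ← Complex.ofReal_sub, Complex.coe_smul,
    Asymptotics.isLittleO_iff, Complex.norm_real]

theorem hasDerivWithinAt_sphere_of_hasDerivAt_exp_mul_I {F : ℂ → E} {w : E} {θ : ℝ}
    (hF : HasDerivAt (fun t : ℝ => F (Complex.exp (t * Complex.I)))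
      ((Complex.exp (θ * Complex.I) * Complex.I) • w) θ) :
    HasDerivWithinAt F w (sphere 0 1) (Complex.exp (θ * Complex.I)) := by
  have hζ0 : Complex.exp (θ * Complex.I) ≠ 0 := Complex.exp_ne_zero _
  have hζ1 : ‖Complex.exp (θ * Complex.I)‖ = 1 := Complex.norm_exp_ofReal_mul_I θ
  generalize hζ : Complex.exp (θ * Complex.I) = ζ at *
  -- A determination of the angle near `ζ`, real on the circle but holomorphic across it.
  let a : ℂ → ℂ := fun z => θ - Complex.log (z / ζ) * Complex.I
  have haζ : a ζ = θ := by simp [a, hζ0]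
  have ha : HasDerivAt a (-(ζ⁻¹ * Complex.I)) ζ := by
    have hdiv : HasDerivAt (fun z => z / ζ) ζ⁻¹ ζ := by
      simpa using (hasDerivAt_id ζ).div_const ζ
    have hlog := hdiv.clog (by simp [hζ0])
    rw [div_self hζ0, div_one] at hlog
    exact (hlog.mul_const Complex.I).const_sub (θ : ℂ)
  have hexp (z : ℂ) (hz : z ∈ sphere (0 : ℂ) 1) : Complex.exp (a z * Complex.I) = z := by
    have haI : a z * Complex.I = θ * Complex.I + Complex.log (z / ζ) := by
      linear_combination -Complex.log (z / ζ) * Complex.I_mul_I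
    rw [haI, Complex.exp_add, Complex.exp_log (div_ne_zero (ne_of_mem_sphere hz one_ne_zero) hζ0),
      hζ, mul_div_cancel₀ _ hζ0]
  have hreal : MapsTo a (sphere 0 1) (range ((↑) : ℝ → ℂ)) := fun z hz => by
    have hzζ : ‖z / ζ‖ = 1 := by rw [norm_div, hζ1, mem_sphere_zero_iff_norm.1 hz, div_one]
    refine ⟨θ + (z / ζ).arg, ?_⟩
    simp only [a, Complex.log, hzζ, Real.log_one]
    push_cast
    linear_combination (z / ζ).arg * Complex.I_mul_I
  have hcomp := (hasDerivWithinAt_range_ofReal_iff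
    (g := fun u => F (Complex.exp (u * Complex.I))).2 hF).scomp_of_eq ζ ha.hasDerivWithinAt hreal
      haζ.symm
  rw [smul_smul, show -(ζ⁻¹ * Complex.I) * (ζ * Complex.I) = 1 by
    rw [neg_mul, mul_mul_mul_comm, inv_mul_cancel₀ hζ0, Complex.I_mul_I, one_mul, neg_neg],
    one_smul] at hcomp
  refine hcomp.congr (fun z hz => ?_) ?_
  · simp only [Function.comp_apply, hexp z hz]
  · simp only [Function.comp_apply, haζ, hζ]

theorem norm_one_sub_conj_mul_eq_norm_sub {z : ℂ} (hz : ‖z‖ = 1) (w : ℂ) :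
    ‖1 - starRingEnd ℂ w * z‖ = ‖z - w‖ := by
  have hzz : starRingEnd ℂ z * z = 1 := by simp [Complex.conj_mul', hz]
  rw [← hzz, ← sub_mul, ← map_sub, norm_mul, RCLike.norm_conj, hz, mul_one]

theorem one_sub_le_norm_sub_real_mul {z ζ : ℂ} (hz : ‖z‖ = 1) (hζ : ‖ζ‖ = 1) {r : ℝ}
    (hr : 0 ≤ r) : 1 - r ≤ ‖z - r * ζ‖ := by
  simpa [hz, hζ, abs_of_nonneg hr] using norm_sub_norm_le z (r * ζ)

theorem norm_sub_le_two_mul_norm_sub_real_mul {z ζ : ℂ} (hz : ‖z‖ = 1) (hζ : ‖ζ‖ = 1) {r : ℝ}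
    (hr : r ∈ Icc 0 1) : ‖z - ζ‖ ≤ 2 * ‖z - r * ζ‖ := by
  have hrζ : ‖r * ζ - ζ‖ = 1 - r := by
    rw [← sub_one_mul, norm_mul, hζ, mul_one, norm_sub_rev, ← Complex.ofReal_one,
      ← Complex.ofReal_sub, Complex.norm_of_nonneg (sub_nonneg.2 hr.2)]
  linarith [norm_sub_le_norm_sub_add_norm_sub z (r * ζ) ζ, one_sub_le_norm_sub_real_mul hz hζ hr.1]

variable {F : ℂ → E} {ζ : ℂ} {r : ℝ}

theorem real_mul_mem_ball (hζ : ‖ζ‖ = 1) (hr : r ∈ Ico 0 1) : (r * ζ : ℂ) ∈ ball (0 : ℂ) 1 := by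
  simpa [hζ, abs_of_nonneg hr.1] using hr.2

theorem norm_le_of_norm_le_mul_norm_sub_real_mul (hF : DiffContOnCl ℂ F (ball 0 1)) (hζ : ‖ζ‖ = 1)
    (hr : r ∈ Ico 0 1) {a b : ℝ}
    (hle : ∀ z ∈ sphere (0 : ℂ) 1, ‖F z‖ ≤ (a + b * ‖z - ζ‖ ^ 2) * ‖z - r * ζ‖) :
    ‖F (r * ζ)‖ ≤ 2 * (a + 2 * b * (1 - r)) * (1 - r) := by
  -- On the unit circle `‖g z‖ = ‖z - r * ζ‖`, so dividing by `g` removes that factor.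
  let g : ℂ → ℂ := fun z => 1 - starRingEnd ℂ (r * ζ) * z
  have hgw : ‖g (r * ζ)‖ = 1 - r ^ 2 := by
    have hζζ : starRingEnd ℂ ζ * ζ = 1 := by simp [Complex.conj_mul', hζ]
    have hsq : g (r * ζ) = ((1 - r ^ 2 : ℝ) : ℂ) := by
      simp only [g, map_mul, Complex.conj_ofReal]
      push_cast
      linear_combination -(r : ℂ) ^ 2 * hζζ
    rw [hsq, Complex.norm_of_nonneg (by nlinarith [hr.1, hr.2])]
  have hg (z : ℂ) (hz : z ∈ closure (ball (0 : ℂ) 1)) : g z ≠ 0 := by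
    rw [closure_ball _ one_ne_zero, mem_closedBall_zero_iff] at hz
    refine sub_ne_zero.2 fun h => (mem_ball_zero_iff.1 (real_mul_mem_ball hζ hr)).not_ge ?_
    rw [← norm_one (α := ℂ), h, norm_mul, RCLike.norm_conj]
    exact mul_le_of_le_one_right (norm_nonneg _) hz
  have hG : DiffContOnCl ℂ (fun z => (g z)⁻¹ • F z) (ball 0 1) :=
    ((by fun_prop : Differentiable ℂ g).diffContOnCl.inv hg).smul hF
  have hGw : ‖(g (r * ζ))⁻¹ • F (r * ζ)‖ ≤ a + 2 * b * (1 - r) := by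
    refine norm_le_of_norm_le_add_mul_sq_on_sphere hG hζ (fun z hz => ?_) (Ico_subset_Icc_self hr)
    have hgz := norm_pos_iff.2 (hg z (by
      rw [closure_ball _ one_ne_zero]
      exact sphere_subset_closedBall hz))
    rw [norm_smul, norm_inv, inv_mul_le_iff₀ hgz, mul_comm,
      norm_one_sub_conj_mul_eq_norm_sub (mem_sphere_zero_iff_norm.1 hz)]
    exact hle z hz
  have hB := (norm_nonneg _).trans hGw
  rw [norm_smul, norm_inv, hgw, inv_mul_le_iff₀ (by nlinarith [hr.1, hr.2])] at hGw
  refine hGw.trans ?_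
  nlinarith [mul_nonneg hB (sq_nonneg (1 - r))]

variable [CompleteSpace E]

theorem norm_deriv_le_of_norm_le_mul_norm_sub_real_mul (hF : DiffContOnCl ℂ F (ball 0 1))
    (hζ : ‖ζ‖ = 1) (hr : r ∈ Ico 0 1) {a b : ℝ}
    (hle : ∀ z ∈ sphere (0 : ℂ) 1, ‖F z‖ ≤ (a + b * ‖z - ζ‖ ^ 2) * ‖z - r * ζ‖) :
    ‖deriv F (r * ζ)‖ ≤ 3 * (a + 2 * b * (1 - r)) := by
  have hw := real_mul_mem_ball hζ hr
  have hFw := norm_le_of_norm_le_mul_norm_sub_real_mul hF hζ hr hle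
  have hdslope : DiffContOnCl ℂ (dslope F (r * ζ)) (ball 0 1) := by
    refine ⟨(Complex.differentiableOn_dslope (isOpen_ball.mem_nhds hw)).2 hF.1, ?_⟩
    exact (continuousOn_dslope (mem_of_superset (isOpen_ball.mem_nhds hw) subset_closure)).2
      ⟨hF.continuousOn, hF.differentiableAt isOpen_ball hw⟩
  have hbound := norm_le_of_norm_le_add_mul_sq_on_sphere hdslope hζ
    (a := a + 2 * (a + 2 * b * (1 - r))) (b := b) (fun z hz => ?_) (Ico_subset_Icc_self hr)
  · rw [dslope_same] at hbound
    linarith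
  · have hz1 := mem_sphere_zero_iff_norm.1 hz
    have hwz := one_sub_le_norm_sub_real_mul hz1 hζ hr.1
    have hwz0 : 0 < ‖z - r * ζ‖ := (sub_pos.2 hr.2).trans_le hwz
    have hB := nonneg_of_mul_nonneg_left ((norm_nonneg _).trans hFw) (sub_pos.2 hr.2)
    rw [dslope_of_ne _ (sub_ne_zero.1 (norm_pos_iff.1 hwz0)), slope_def_module, norm_smul, norm_inv,
      inv_mul_le_iff₀ hwz0]
    calc ‖F z - F (r * ζ)‖ ≤ ‖F z‖ + ‖F (r * ζ)‖ := norm_sub_le _ _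
      _ ≤ (a + b * ‖z - ζ‖ ^ 2) * ‖z - r * ζ‖ + 2 * (a + 2 * b * (1 - r)) * ‖z - r * ζ‖ := by
        gcongr
        · exact hle z hz
        · exact hFw.trans (by gcongr)
      _ = ‖z - r * ζ‖ * (a + 2 * (a + 2 * b * (1 - r)) + b * ‖z - ζ‖ ^ 2) := by ring

theorem tendsto_deriv_radial_of_isLittleO (hF : DiffContOnCl ℂ F (ball 0 1)) (hζ : ‖ζ‖ = 1)
    (hFζ : F =o[𝓝[sphere 0 1] ζ] fun z => z - ζ) :
    Tendsto (fun r : ℝ => deriv F (r * ζ)) (𝓝[<] 1) (𝓝 0) := by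
  obtain ⟨M, hM⟩ := (isCompact_sphere (0 : ℂ) 1).exists_bound_of_continuousOn
    (hF.continuousOn_ball.mono sphere_subset_closedBall)
  have hbound (ε : ℝ) (hε : 0 < ε) :
      ∃ C, ∀ r ∈ Ico (0 : ℝ) 1, ‖deriv F (r * ζ)‖ ≤ 6 * ε + 12 * C * (1 - r) := by
    obtain ⟨C, hC, hle⟩ := exists_norm_le_add_mul_sq_mul_of_isLittleO hM hFζ hε
    refine ⟨C, fun r hr => ?_⟩
    have := norm_deriv_le_of_norm_le_mul_norm_sub_real_mul hF hζ hr (a := 2 * ε) (b := 2 * C)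
      fun z hz => ?_
    · linarith
    · have := norm_sub_le_two_mul_norm_sub_real_mul (mem_sphere_zero_iff_norm.1 hz) hζ
        (Ico_subset_Icc_self hr)
      calc ‖F z‖ ≤ (ε + C * ‖z - ζ‖ ^ 2) * ‖z - ζ‖ := hle z hz
        _ ≤ (ε + C * ‖z - ζ‖ ^ 2) * (2 * ‖z - r * ζ‖) := by gcongr
        _ = (2 * ε + 2 * C * ‖z - ζ‖ ^ 2) * ‖z - r * ζ‖ := by ring
  refine Metric.tendsto_nhds.2 fun ε hε => ?_
  obtain ⟨C, hC⟩ := hbound (ε / 12) (by positivity)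
  have hlim : Tendsto (fun r : ℝ => 6 * (ε / 12) + 12 * C * (1 - r)) (𝓝[<] 1) (𝓝 (ε / 2)) := by
    refine tendsto_nhdsWithin_of_tendsto_nhds (Continuous.tendsto' (by fun_prop) _ _ ?_)
    ring
  filter_upwards [hlim.eventually_lt_const (half_lt_self hε), Ico_mem_nhdsLT zero_lt_one]
    with r hrε hr
  rw [dist_zero_right]
  exact (hC r hr).trans_lt hrε

theorem tendsto_deriv_radial_of_hasDerivWithinAt_sphere (hF : DiffContOnCl ℂ F (ball 0 1))
    (hζ : ‖ζ‖ = 1) {w : E} (hd : HasDerivWithinAt F w (sphere 0 1) ζ) :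
    Tendsto (fun r : ℝ => deriv F (r * ζ)) (𝓝[<] 1) (𝓝 w) := by
  have hlin (z : ℂ) : HasDerivAt (fun z => F ζ + (z - ζ) • w) w z := by
    simpa using (((hasDerivAt_id z).sub_const ζ).smul_const w).const_add (F ζ)
  have hlim := tendsto_deriv_radial_of_isLittleO
    (hF.sub (Differentiable.diffContOnCl fun z => (hlin z).differentiableAt)) hζ
    (by simpa only [Pi.sub_def, sub_sub] using hd.isLittleO)
  rw [← tendsto_sub_nhds_zero_iff]
  refine hlim.congr' ?_
  filter_upwards [Ico_mem_nhdsLT zero_lt_one] with r hr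
  exact ((hF.differentiableAt isOpen_ball (real_mul_mem_ball hζ hr)).hasDerivAt.sub
    (hlin _)).deriv

end RadialDerivative

section Primitive

open Metric

/-- The primitive of `hardyMap c` vanishing at the origin, defined by its power series, which
converges on the closed unit disk. -/
noncomputable def hardyPrimitive (c : EllTwo) : ℂ → ℂ :=
  fun z => ∑' n : ℕ, c n * z ^ (n + 1) / (n + 1)

theorem summable_norm_div_succ (c : EllTwo) : Summable fun n : ℕ => ‖c n‖ / (n + 1) := by
  have hinv : Summable fun n : ℕ => ((n : ℝ) + 1)⁻¹ ^ 2 := by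
    simpa using (summable_nat_add_iff 1).2 (Real.summable_nat_pow_inv.2 one_lt_two)
  refine Summable.of_nonneg_of_le (fun n => by positivity) (fun n => ?_)
    ((EllTwo.hasSum_sq c).summable.add hinv)
  rw [div_eq_mul_inv]
  nlinarith [two_mul_le_add_sq ‖c n‖ ((n : ℝ) + 1)⁻¹, sq_nonneg ‖c n‖, sq_nonneg ((n : ℝ) + 1)⁻¹]

theorem norm_hardyPrimitive_term_le (c : EllTwo) (n : ℕ) {z : ℂ} (hz : z ∈ closedBall (0 : ℂ) 1) :
    ‖c n * z ^ (n + 1) / (n + 1)‖ ≤ ‖c n‖ / (n + 1) := by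
  have hn : ‖(n : ℂ) + 1‖ = n + 1 := by exact_mod_cast Complex.norm_natCast (n + 1)
  rw [norm_div, norm_mul, norm_pow, hn]
  gcongr
  exact mul_le_of_le_one_right (norm_nonneg _)
    (pow_le_one₀ (norm_nonneg _) (mem_closedBall_zero_iff.1 hz))

theorem hasSum_hardyPrimitive (c : EllTwo) {z : ℂ} (hz : z ∈ closedBall (0 : ℂ) 1) :
    HasSum (fun n : ℕ => c n * z ^ (n + 1) / (n + 1)) (hardyPrimitive c z) :=
  (Summable.of_norm_bounded (summable_norm_div_succ c)
    fun n => norm_hardyPrimitive_term_le c n hz).hasSum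

theorem diffContOnCl_hardyPrimitive (c : EllTwo) :
    DiffContOnCl ℂ (hardyPrimitive c) (ball 0 1) where
  differentiableOn :=
    Complex.differentiableOn_tsum_of_summable_norm (summable_norm_div_succ c)
      (fun n => by fun_prop) isOpen_ball
      fun n z hz => norm_hardyPrimitive_term_le c n (ball_subset_closedBall hz)
  continuousOn := by
    rw [closure_ball 0 one_ne_zero]
    exact continuousOn_tsum (fun n => by fun_prop) (summable_norm_div_succ c)
      fun n z hz => norm_hardyPrimitive_term_le c n hz

theorem deriv_hardyPrimitive (c : EllTwo) {z : ℂ} (hz : z ∈ ball (0 : ℂ) 1) :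
    deriv (hardyPrimitive c) z = hardyMap c z := by
  have hsum := Complex.hasSum_deriv_of_summable_norm (summable_norm_div_succ c)
    (F := fun (n : ℕ) z => c n * z ^ (n + 1) / (n + 1)) (fun n => by fun_prop) isOpen_ball
    (fun n z hz => norm_hardyPrimitive_term_le c n (ball_subset_closedBall hz)) hz
  refine hsum.tsum_eq.symm.trans (tsum_congr fun n => ?_)
  have hn : (n : ℂ) + 1 ≠ 0 := n.cast_add_one_ne_zero
  have hterm : HasDerivAt (fun z : ℂ => c n * z ^ (n + 1) / (n + 1))
      (c n * (((n + 1 : ℕ) : ℂ) * z ^ n) / (n + 1)) z := by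
    simpa using ((hasDerivAt_pow (n + 1) z).const_mul (c n)).div_const ((n : ℂ) + 1)
  rw [hterm.deriv]
  push_cast
  field_simp

end Primitive

section Fatou

open AddCircle

variable {T : ℝ} [hT : Fact (0 < T)] {E : Type*} [NormedAddCommGroup E]

theorem quasiMeasurePreserving_coe_haarAddCircle :
    Measure.QuasiMeasurePreserving (fun t : ℝ => (t : AddCircle T))
      (volume.restrict (Ioc 0 T)) haarAddCircle := by
  have hmp := (AddCircle.measurePreserving_mk T 0).quasiMeasurePreserving
  rw [zero_add] at hmp
  refine hmp.mono_right ?_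
  rw [volume_eq_smul_haarAddCircle]
  exact Measure.smul_absolutelyContinuous

theorem intervalIntegrable_coe_of_integrable_haarAddCircle {g : AddCircle T → E}
    (hg : Integrable g haarAddCircle) :
    IntervalIntegrable (fun t : ℝ => g t) volume 0 T := by
  have hmp := AddCircle.measurePreserving_mk T 0
  rw [zero_add, volume_eq_smul_haarAddCircle] at hmp
  rw [intervalIntegrable_iff_integrableOn_Ioc_of_le hT.out.le]
  exact hmp.integrable_comp_of_integrable (hg.smul_measure ENNReal.ofReal_ne_top)

theorem exists_measurableSet_setIntegral_haarAddCircle [NormedSpace ℝ E] {θ : ℝ}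
    (hθ : θ ∈ Icc 0 T) :
    ∃ s : Set (AddCircle T), MeasurableSet s ∧ ∀ g : AddCircle T → E,
      ∫ x in s, g x ∂haarAddCircle = T⁻¹ • ∫ t in (0 : ℝ)..θ, g t := by
  have hs : MeasurableSet {x : AddCircle T | (equivIoc T 0 x : ℝ) ≤ θ} :=
    (measurable_subtype_coe.comp (measurableEquivIoc T 0).measurable) measurableSet_Iic
  refine ⟨_, hs, fun g => ?_⟩
  have hIoc : Ioc 0 (0 + T) ∩ Iic θ = Ioc 0 θ := by
    rw [zero_add, Ioc_inter_Iic, min_eq_right hθ.2]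
  rw [← integral_indicator hs, integral_haarAddCircle, ← AddCircle.integral_preimage T 0,
    intervalIntegral.integral_of_le hθ.1, ← hIoc, ← setIntegral_indicator measurableSet_Iic]
  congr 1
  refine setIntegral_congr_fun measurableSet_Ioc fun t ht => ?_
  simp only [indicator_apply, mem_ofPred_eq, equivIoc_coe_of_mem ht, mem_Iic]

theorem hasSum_intervalIntegral_hardyBoundary (c : EllTwo) {θ : ℝ} (hθ : θ ∈ Icc 0 T) :
    HasSum (fun n : ℕ => c n * ∫ t in (0 : ℝ)..θ, fourier (n : ℤ) (t : AddCircle T))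
      (∫ t in (0 : ℝ)..θ, hardyBoundary T c t) := by
  obtain ⟨s, hs, hint⟩ := exists_measurableSet_setIntegral_haarAddCircle (E := ℂ) hθ
  have hinner (g : Lp ℂ 2 (@haarAddCircle T hT)) :
      inner ℂ (indicatorConstLp 2 hs (measure_ne_top _ s) (1 : ℂ)) g =
        T⁻¹ • ∫ t in (0 : ℝ)..θ, g t := by
    rw [L2.inner_indicatorConstLp_one, hint]
  have hsum := ((hasSum_hardyBoundary c).mapL
    (innerSL ℂ (indicatorConstLp 2 hs (measure_ne_top _ s) (1 : ℂ)))).const_smul T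
  simp only [innerSL_apply_apply, map_smul, hinner, smul_inv_smul₀ hT.out.ne'] at hsum
  refine hsum.congr_fun fun n => ?_
  have hfourier : ∫ x in s, fourierLp (T := T) 2 n x ∂haarAddCircle =
      ∫ x in s, fourier (n : ℤ) x ∂haarAddCircle :=
    integral_congr_ae (ae_restrict_of_ae (coeFn_fourierLp 2 (n : ℤ)))
  rw [hint, hint] at hfourier
  rw [hfourier, smul_comm, smul_inv_smul₀ hT.out.ne', smul_eq_mul]

instance fact_zero_lt_two_pi : Fact (0 < 2 * Real.pi) := ⟨Real.two_pi_pos⟩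

theorem fourier_coe_two_pi (n : ℤ) (t : ℝ) :
    fourier n (t : AddCircle (2 * Real.pi)) = Complex.exp (n * Complex.I * t) := by
  have hπ : (Real.pi : ℂ) ≠ 0 := Complex.ofReal_ne_zero.2 Real.pi_ne_zero
  rw [fourier_coe_apply]
  congr 1
  push_cast
  field_simp

theorem integral_fourier_succ (n : ℕ) (θ : ℝ) :
    ∫ t in (0 : ℝ)..θ, fourier ((n + 1 : ℕ) : ℤ) (t : AddCircle (2 * Real.pi)) =
      -Complex.I * ((Complex.exp (θ * Complex.I) ^ (n + 1) - 1) / (n + 1)) := by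
  have hn : (n : ℂ) + 1 ≠ 0 := n.cast_add_one_ne_zero
  have hnI : (((n + 1 : ℕ) : ℤ) : ℂ) * Complex.I ≠ 0 := by
    push_cast
    exact mul_ne_zero hn Complex.I_ne_zero
  simp only [fourier_coe_two_pi]
  rw [integral_exp_mul_complex hnI, ← Complex.exp_nat_mul, Complex.ofReal_zero, mul_zero,
    Complex.exp_zero, Int.cast_natCast, mul_right_comm, mul_assoc, div_mul_eq_div_div_swap,
    Complex.div_I]
  push_cast
  ring

-- The shift supplies the factor `e^{it}` of the velocity `i e^{it}` of the circle.
theorem integral_hardyBoundary_rightShift (c : EllTwo) {θ : ℝ} (hθ : θ ∈ Icc 0 (2 * Real.pi)) :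
    ∫ t in (0 : ℝ)..θ, hardyBoundary (2 * Real.pi) (rightShift c) t =
      -Complex.I * (hardyPrimitive c (Complex.exp (θ * Complex.I)) - hardyPrimitive c 1) := by
  have hint := hasSum_intervalIntegral_hardyBoundary (rightShift c) hθ
  rw [← hasSum_nat_add_iff' 1, Finset.sum_range_one, rightShift_apply_zero, zero_mul,
    sub_zero] at hint
  have hprim := ((hasSum_hardyPrimitive c (z := Complex.exp (θ * Complex.I))
    (by simp [Complex.norm_exp_ofReal_mul_I])).sub
      (hasSum_hardyPrimitive c (z := 1) (by simp))).mul_left (-Complex.I)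
  refine hint.unique (hprim.congr_fun fun n => ?_)
  rw [integral_fourier_succ, rightShift_apply_succ]
  ring

theorem ae_hasDerivAt_hardyPrimitive_exp_mul_I (c : EllTwo) :
    ∀ᵐ θ : ℝ ∂volume.restrict (Ioc 0 (2 * Real.pi)),
      HasDerivAt (fun t : ℝ => hardyPrimitive c (Complex.exp (t * Complex.I)))
        ((Complex.exp (θ * Complex.I) * Complex.I) • hardyBoundary (2 * Real.pi) c θ) θ := by
  have hint := intervalIntegrable_coe_of_integrable_haarAddCircle
    (integrable_coeFn_lp_two (hardyBoundary (2 * Real.pi) (rightShift c)))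
  have hshift := quasiMeasurePreserving_coe_haarAddCircle.ae
    (hardyBoundary_rightShift_pow (T := 2 * Real.pi) c 1)
  rw [← Measure.restrict_congr_set Ioo_ae_eq_Ioc, ae_restrict_iff' measurableSet_Ioo] at hshift ⊢
  filter_upwards [hint.ae_hasDerivAt_integral, hshift] with θ hderiv hθ hmem
  rw [uIcc_of_le Real.two_pi_pos.le] at hderiv
  have hd := ((hderiv (Ioo_subset_Icc_self hmem) 0
    (left_mem_Icc.2 Real.two_pi_pos.le)).const_mul Complex.I).add_const (hardyPrimitive c 1)
  rw [pow_one] at hθ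
  have hslope : Complex.I * hardyBoundary (2 * Real.pi) (rightShift c) θ =
      (Complex.exp (θ * Complex.I) * Complex.I) • hardyBoundary (2 * Real.pi) c θ := by
    rw [hθ hmem, fourier_coe_two_pi, Nat.cast_one, Int.cast_one, one_mul, mul_comm _ (θ : ℂ),
      smul_eq_mul, mul_left_comm, mul_assoc]
  rw [hslope] at hd
  refine hd.congr_of_eventuallyEq ?_
  filter_upwards [Ioo_mem_nhds hmem.1 hmem.2] with t ht
  rw [integral_hardyBoundary_rightShift c (Ioo_subset_Icc_self ht)]
  linear_combination (hardyPrimitive c (Complex.exp (t * Complex.I)) - hardyPrimitive c 1) *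
    Complex.I_mul_I

theorem ae_tendsto_hardyMap_radial (c : EllTwo) :
    ∀ᵐ θ : ℝ ∂volume.restrict (Ioc 0 (2 * Real.pi)),
      Tendsto (fun r : ℝ => hardyMap c (r * Complex.exp (θ * Complex.I))) (𝓝[<] 1)
        (𝓝 (hardyBoundary (2 * Real.pi) c θ)) := by
  filter_upwards [ae_hasDerivAt_hardyPrimitive_exp_mul_I c] with θ hθ
  have hnorm := Complex.norm_exp_ofReal_mul_I θ
  refine (tendsto_deriv_radial_of_hasDerivWithinAt_sphere (diffContOnCl_hardyPrimitive c) hnorm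
    (hasDerivWithinAt_sphere_of_hasDerivAt_exp_mul_I hθ)).congr' ?_
  filter_upwards [Ico_mem_nhdsLT zero_lt_one] with r hr
  exact deriv_hardyPrimitive c (real_mul_mem_ball hnorm hr)

theorem isInnerFunction_hardyMap {c : EllTwo}
    (hc : ∀ᵐ x ∂(@haarAddCircle (2 * Real.pi) _), ‖hardyBoundary (2 * Real.pi) c x‖ = 1) :
    IsInnerFunction (hardyMap c) := by
  refine ⟨memHardyTwo_hardyMap c, ?_⟩
  filter_upwards [ae_tendsto_hardyMap_radial c, quasiMeasurePreserving_coe_haarAddCircle.ae hc]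
    with θ hlim hnorm
  exact ⟨_, hnorm, hlim⟩

end Fatou

theorem mapsTo_rightShift_iff_eq_bot_or_exists_isInnerFunction {N : Submodule ℂ EllTwo}
    (hN : IsClosed (N : Set EllTwo)) :
    MapsTo rightShift N N ↔ N = ⊥ ∨ ∃ c : EllTwo, IsInnerFunction (hardyMap c) ∧
      N = (Submodule.span ℂ (range fun n : ℕ => (rightShift ^ n) c)).topologicalClosure := by
  constructor
  · refine fun hS => or_iff_not_imp_left.2 fun h0 => ?_
    obtain ⟨c, hc, hNc⟩ :=
      exists_norm_hardyBoundary_eq_one_and_eq_topologicalClosure_span (2 * Real.pi) hN hS h0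
    exact ⟨c, isInnerFunction_hardyMap hc, hNc⟩
  · rintro (rfl | ⟨c, -, rfl⟩)
    · rintro x rfl
      exact map_zero rightShift
    · exact mapsTo_topologicalClosure_span_range_pow rightShift c

theorem theorem15_general {H : Type*} [NormedAddCommGroup H] [InnerProductSpace ℂ H]
    [CompleteSpace H] (f : ℕ → H) (hf : IsFrame f) :
    (∃ T : H →L[ℂ] H, ∀ n : ℕ, f n = (T ^ n) (f 0)) ↔
      (IsRieszBasis f ∨
        ∃ c : EllTwo, IsInnerFunction (hardyMap c) ∧
          (synthesisOperator f hf).ker =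
            (Submodule.span ℂ (Set.range fun n : ℕ => (rightShift ^ n) c)).topologicalClosure) := by
  rw [exists_eq_pow_apply_iff_mapsTo_ker hf, isRieszBasis_iff_ker_synthesisOperator_eq_bot hf]
  exact mapsTo_rightShift_iff_eq_bot_or_exists_isInnerFunction
    (synthesisOperator f hf).isClosed_ker

theorem theorem15 {H : Type*} [NormedAddCommGroup H] [InnerProductSpace ℂ H] [CompleteSpace H]
    (f : ℕ → H) (hf : IsFrame f) (hli : LinearIndependent ℂ f) :
    (∃ T : H →L[ℂ] H, ∀ n : ℕ, f n = (T ^ n) (f 0)) ↔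
      (IsRieszBasis f ∨
        ∃ c : EllTwo, IsInnerFunction (hardyMap c) ∧
          (synthesisOperator f hf).ker =
            (Submodule.span ℂ (Set.range fun n : ℕ => (rightShift ^ n) c)).topologicalClosure) :=
  theorem15_general f hf
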